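/- **Theorem 3.3 (local convergence of RGPS).** Let $n\ge 1$, $A=[a_1,\dots,a_m]\in\mathbb C^{n\times m}$ with $A^*$ of full column rank, $x^\natural\in\mathbb C^n$, $y^\natural=A^*x^\natural$, $z^\natural=(x^\natural,y^\natural)\in\mathbb C^{n+m}$, and $b=|y^\natural|$ (elementwise) with all $b_i>0$. Assume that magnitude retrieval is unique: every $x\in\mathbb C^n$ with $\frac{a_i^*x}{|a_i^*x|}=\pm\frac{a_i^*x^\natural}{|a_i^*x^\natural|}$ for all $i$ (signs depending on $i$, and $0/|0|:=0$) equals $c\,x^\natural$ for some $c\in\mathbb R\setminus\{0\}$. *Algorithm.* Let $\Pi$ be the orthogonal projection of $\mathbb C^{n+m}$ onto the graph $\{(x,y):A^*x=y\}$ and $t\in\mathbb R$. RGPS (noiseless, without prior) is the iteration, from arbitrary $x^0,\lambda^0\in\mathbb C^n$ and $y^0,\nu^0\in\mathbb C^m$, $$(x^{k+\frac12},y^{k+\frac12})=(tI+(1-t)\Pi)(x^k-\lambda^k,\,y^k-\nu^k),$$ $$x^{k+1}=x^{k+\frac12}+\lambda^k,\qquad y^{k+1}=b\circ\frac{y^{k+\frac12}+\nu^k}{|y^{k+\frac12}+\nu^k|},$$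 $$\lambda^{k+1}=\lambda^k+x^{k+\frac12}-x^{k+1},\qquad \nu^{k+1}=\nu^k+y^{k+\frac12}-y^{k+1},$$ with elementwise operations and $0/|0|:=0$. Put $z_{\mathrm{DR}}^k=(\lambda^k+x^k,\nu^k+y^k)$. For $k\ge1$ it satisfies $z_{\mathrm{DR}}^{k+1}=T(z_{\mathrm{DR}}^k)$, where $T(z)=z+(tI+(1-t)\Pi)(2P(z)-z)-P(z)$ and $P(x,y)=(x,\,b\circ y/|y|)$. Let $\operatorname{dist}(u,v)=\min_{|\alpha|=1}\|u-\alpha v\|$ and $\mathcal F_0=\{\alpha z^\natural:|\alpha|=1\}$. *Constants.* Let $L\in\mathbb C^{n\times n}$ satisfy $LL^*=I+AA^*$ (e.g. the Cholesky factor), let $\Omega$ be a diagonal unitary matrix whose diagonal entries are the phases of the entries of $z^\natural$ (an arbitrary unimodular number where an entry of $x^\natural$ is zero), and let $B=(L^{-1},\,L^{-1}A)\,\Omega$. Let $\sigma_2$ be the second largest singular value (with multiplicity) of the real matrix $\begin{pmatrix}\operatorname{Re}B\\ \operatorname{Im}B\end{pmatrix}\in\mathbb R^{2n\times(n+m)}$,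 let $s_{\min}(A)$ be the smallest nonzero singular value of $A$, and set $$\delta_1=\frac1{\sqrt{1+s_{\min}(A)^2}},\qquad \tilde\beta^2=\max\{\sigma_2^2+(1-\sigma_2^2)\delta_1^2,\ \sigma_2^2\}\ \ (\tilde\beta\ge0),\qquad t_{\max}=\frac{2(1-\tilde\beta^2)}{2-\tilde\beta^2}.$$ *Claim.* One has $0<\tilde\beta<1$ and $0<t_{\max}<1$, and for every $t$ with $0<t<t_{\max}$ there are $0<\gamma<1$, a function $\varepsilon$ with $\varepsilon(\rho)\to0$ as $\rho\downarrow0$, and $r>0$ such that 1. among the points $z$ with $\operatorname{dist}(z,z^\natural)<r$, the fixed points of $T$ are exactly the elements of $\mathcal F_0$; 2. for every RGPS sequence with $\rho:=\operatorname{dist}(z_{\mathrm{DR}}^1,z^\natural)<r$ and every $k\ge1$, $$\operatorname{dist}(x^k,x^\natural)\le(\gamma+\varepsilon(\rho))^{k-1}\rho .$$ -/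

import Mathlib

open Filter Topology
open scoped Matrix

noncomputable section

namespace PhaseRetrieval

/-- The stacked space `ℂⁿ⁺ᵐ ∋ (x, y)` with its Euclidean norm. -/
abbrev Stacked (n m : ℕ) : Type :=
  WithLp 2 (EuclideanSpace ℂ (Fin n) × EuclideanSpace ℂ (Fin m))

/-- The stacked vector `(x, y)`. -/
abbrev stack {n m : ℕ} (x : EuclideanSpace ℂ (Fin n)) (y : EuclideanSpace ℂ (Fin m)) :
    Stacked n m :=
  WithLp.toLp 2 (x, y)

/-- The measurement map `x ↦ A* x`, where the columns of `A` are the sampling vectors. -/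
def meas {n m : ℕ} (A : Matrix (Fin n) (Fin m) ℂ) :
    EuclideanSpace ℂ (Fin n) →ₗ[ℂ] EuclideanSpace ℂ (Fin m) :=
  Matrix.toEuclideanLin Aᴴ

/-- The graph `{(x, y) | A* x = y}`. -/
def graphSet {n m : ℕ} (A : Matrix (Fin n) (Fin m) ℂ) : Submodule ℂ (Stacked n m) where
  carrier := {z | meas A z.fst = z.snd}
  add_mem' := by
    intro a b ha hb
    simp only [Set.mem_ofPred_eq] at ha hb ⊢
    simp [ha, hb]
  zero_mem' := by simp
  smul_mem' := by
    intro c a ha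
    simp only [Set.mem_ofPred_eq] at ha ⊢
    simp [ha]

/-- The orthogonal projection onto the graph. -/
def graphProj {n m : ℕ} (A : Matrix (Fin n) (Fin m) ℂ) : Stacked n m →L[ℂ] Stacked n m :=
  (graphSet A).starProjection

/-- The robust graph projection `t I + (1 - t) Π`. -/
def robustProj {n m : ℕ} (A : Matrix (Fin n) (Fin m) ℂ) (t : ℝ) (z : Stacked n m) :
    Stacked n m :=
  (t : ℂ) • z + ((1 - t : ℝ) : ℂ) • graphProj A z

/-- The phase `z / |z|` of a complex number, equal to `0` at `z = 0`. -/
def phase (z : ℂ) : ℂ := z / (‖z‖ : ℂ)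

/-- The proximity operator of the indicator function of `{y | |y| = b}`, that is the elementwise
product `b ∘ y / |y|`, with `0 / |0| = 0`. -/
def proxF {m : ℕ} (b : Fin m → ℝ) (y : EuclideanSpace ℂ (Fin m)) : EuclideanSpace ℂ (Fin m) :=
  WithLp.toLp 2 fun i => (b i : ℂ) * phase (y i)

/-- The proximity operator of `φ(x, y) = f(y) + g(x)` with `g = 0`: the identity in `x`. -/
def proxPhi {n m : ℕ} (b : Fin m → ℝ) (z : Stacked n m) : Stacked n m :=
  stack z.fst (proxF b z.snd)

/-- The primal variables `x, y` and the dual variables `lam, nu` of the splitting iteration. -/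
structure State (n m : ℕ) where
  x : EuclideanSpace ℂ (Fin n)
  y : EuclideanSpace ℂ (Fin m)
  lam : EuclideanSpace ℂ (Fin n)
  nu : EuclideanSpace ℂ (Fin m)

/-- One iteration of robust graph projection splitting without prior (`g = 0`). -/
def rgpsStep {n m : ℕ} (A : Matrix (Fin n) (Fin m) ℂ) (b : Fin m → ℝ) (t : ℝ)
    (s : State n m) : State n m :=
  let h := robustProj A t (stack (s.x - s.lam) (s.y - s.nu))
  let p := proxPhi b (stack (h.fst + s.lam) (h.snd + s.nu))
  { x := p.fst
    y := p.snd
    lam := s.lam + h.fst - p.fst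
    nu := s.nu + h.snd - p.snd }

/-- The Douglas-Rachford variable `(lam + x, nu + y)` attached to a state. -/
def State.dr {n m : ℕ} (s : State n m) : Stacked n m := stack (s.lam + s.x) (s.nu + s.y)

/-- The iteration map of RGPS in the single Douglas-Rachford variable. -/
def rgpsDRStep {n m : ℕ} (A : Matrix (Fin n) (Fin m) ℂ) (b : Fin m → ℝ) (t : ℝ)
    (z : Stacked n m) : Stacked n m :=
  z + robustProj A t ((2 : ℂ) • proxPhi b z - z) - proxPhi b z

/-- The distance up to a global phase, `min_{|α| = 1} ‖u - α v‖`. -/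
def phaseDist {E : Type*} [NormedAddCommGroup E] [Module ℂ E] (u v : E) : ℝ :=
  ⨅ α : Circle, ‖u - (α : ℂ) • v‖

/-- The set `{α z | |α| = 1}`. -/
def phaseOrbit {n m : ℕ} (z : Stacked n m) : Set (Stacked n m) :=
  {w | ∃ α : Circle, w = (α : ℂ) • z}

/-- Uniqueness of magnitude retrieval: the vectors `x` such that each `a_i* x` has the same phase
as `a_i* xs` up to sign are the nonzero real multiples of `xs`. -/
def MagnitudeRetrievalUnique {n m : ℕ} (A : Matrix (Fin n) (Fin m) ℂ)
    (xs : EuclideanSpace ℂ (Fin n)) : Prop :=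
  ∀ x : EuclideanSpace ℂ (Fin n),
    (∀ i, phase (meas A x i) = phase (meas A xs i) ∨
      phase (meas A x i) = -phase (meas A xs i)) →
    ∃ c : ℝ, c ≠ 0 ∧ x = (c : ℂ) • xs

/-- `C = (L⁻¹, L⁻¹ A)`, for a factor `L` of `I + A A* = L L*`. -/
def matC {n m : ℕ} (A : Matrix (Fin n) (Fin m) ℂ) (L : Matrix (Fin n) (Fin n) ℂ) :
    Matrix (Fin n) (Fin n ⊕ Fin m) ℂ :=
  Matrix.fromCols L⁻¹ (L⁻¹ * A)

/-- `B = C Ω`, where `Ω` is the diagonal matrix with entries `ωx` and the phases of `A* xs`. -/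
def matB {n m : ℕ} (A : Matrix (Fin n) (Fin m) ℂ) (L : Matrix (Fin n) (Fin n) ℂ)
    (xs : EuclideanSpace ℂ (Fin n)) (ωx : Fin n → ℂ) : Matrix (Fin n) (Fin n ⊕ Fin m) ℂ :=
  matC A L * Matrix.diagonal (Sum.elim ωx fun i => phase (meas A xs i))

/-- The real form of `B`: its real part stacked on its imaginary part. -/
def realB {n m : ℕ} (A : Matrix (Fin n) (Fin m) ℂ) (L : Matrix (Fin n) (Fin n) ℂ)
    (xs : EuclideanSpace ℂ (Fin n)) (ωx : Fin n → ℂ) :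
    Matrix (Fin n ⊕ Fin n) (Fin n ⊕ Fin m) ℝ :=
  Matrix.fromRows ((matB A L xs ωx).map Complex.re) ((matB A L xs ωx).map Complex.im)

/-- The second largest singular value of the real form of `B` (Mathlib counts from zero). -/
def sigma2 {n m : ℕ} (A : Matrix (Fin n) (Fin m) ℂ) (L : Matrix (Fin n) (Fin n) ℂ)
    (xs : EuclideanSpace ℂ (Fin n)) (ωx : Fin n → ℂ) : ℝ :=
  (Matrix.toEuclideanLin (realB A L xs ωx)).singularValues 1

/-- The smallest nonzero singular value of `A`. -/
def sMin {n m : ℕ} (A : Matrix (Fin n) (Fin m) ℂ) : ℝ :=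
  sInf {s : ℝ | s ≠ 0 ∧ ∃ i : ℕ, s = (Matrix.toEuclideanLin A).singularValues i}

/-- `δ₁ = 1 / √(1 + s_min(A)²)`. -/
def delta1 {n m : ℕ} (A : Matrix (Fin n) (Fin m) ℂ) : ℝ := 1 / √(1 + sMin A ^ 2)

/-- `β̃`, where `β̃² = max {σ₂² + (1 - σ₂²) δ₁², σ₂²}`. -/
def betaTilde {n m : ℕ} (A : Matrix (Fin n) (Fin m) ℂ) (L : Matrix (Fin n) (Fin n) ℂ)
    (xs : EuclideanSpace ℂ (Fin n)) (ωx : Fin n → ℂ) : ℝ :=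
  √(max (sigma2 A L xs ωx ^ 2 + (1 - sigma2 A L xs ωx ^ 2) * delta1 A ^ 2)
    (sigma2 A L xs ωx ^ 2))

/-- `t_max = 2 (1 - β̃²) / (2 - β̃²)` as a function of `β̃`. -/
def tMax (β : ℝ) : ℝ := 2 * (1 - β ^ 2) / (2 - β ^ 2)

end PhaseRetrieval

end

namespace PhaseRetrieval

/-! The Douglas-Rachford map `T` commutes with global phases and fixes `z♮`, so everything is
decided by its real derivative there. Write `Q` for the derivative of the prox, a real orthogonal
projection, and split `v = q + p` with `q = Q v`. The derivative sends `v` to `Π q + t (q - Π q) +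
(1 - t) (p - Π p)`. For `0 < t < 1` its norm is at most `‖v‖`, with equality only if `p = 0` and `q`
lies in the graph (`eq_zero_and_mem_of_norm_le_relaxed`). Unique magnitude retrieval then makes `v`
an imaginary multiple of `z♮`, that is, tangent to the phase orbit (`norm_rgpsDRStep_deriv_lt`).

The best-aligned phase makes the error real-orthogonal to that tangent (`exists_phaseDist_eq`). On
this hyperplane compactness gives a uniform factor `g < 1`, and differentiability extends the
contraction to a ball (`exists_phaseDist_rgpsDRStep_le`). This yields both claims. The rate comes
from compactness; of `β̃` only `0 < β̃ < 1` is needed, which gives `t < t_max < 1`. The bound `σ₂ <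
1` is the same uniqueness argument applied to `B`. -/

/-! ### Coisometries and the second singular value. -/

theorem norm_sq_add_norm_sub_sq_of_coisometry {E F : Type*} [NormedAddCommGroup E]
    [InnerProductSpace ℂ E] [FiniteDimensional ℂ E] [NormedAddCommGroup F]
    [InnerProductSpace ℂ F] [FiniteDimensional ℂ F] (S : E →ₗ[ℂ] F)
    (hS : ∀ v, S (S.adjoint v) = v) (u : E) :
    ‖S u‖ ^ 2 + ‖u - S.adjoint (S u)‖ ^ 2 = ‖u‖ ^ 2 := by
  have h1 : inner ℂ u (S.adjoint (S u)) = ((‖S u‖ ^ 2 : ℝ) : ℂ) := by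
    rw [LinearMap.adjoint_inner_right, inner_self_eq_norm_sq_to_K]; norm_cast
  have h2 : ‖S.adjoint (S u)‖ ^ 2 = ‖S u‖ ^ 2 := by
    have : inner ℂ (S.adjoint (S u)) (S.adjoint (S u)) = ((‖S u‖ ^ 2 : ℝ) : ℂ) := by
      rw [LinearMap.adjoint_inner_right, hS, inner_self_eq_norm_sq_to_K]; norm_cast
    rw [inner_self_eq_norm_sq_to_K] at this
    exact Complex.ofReal_injective (by simpa using this)
  rw [@norm_sub_sq ℂ, h1, h2, RCLike.re_eq_complex_re, Complex.ofReal_re]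
  ring

/-- If the two leading singular values were at least 1, their orthonormal eigenvectors of `T* T`
would both attain `‖T v‖ = ‖v‖`, hence lie on the single line through `w`. -/
theorem singularValues_one_lt_one {E F : Type*} [NormedAddCommGroup E]
    [InnerProductSpace ℝ E] [FiniteDimensional ℝ E] [NormedAddCommGroup F]
    [InnerProductSpace ℝ F] [FiniteDimensional ℝ F] (T : E →ₗ[ℝ] F) (w : E)
    (hle : ∀ v, ‖T v‖ ≤ ‖v‖) (heq : ∀ v, ‖T v‖ = ‖v‖ → ∃ c : ℝ, v = c • w) :
    T.singularValues 1 < 1 := by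
  by_contra! h
  -- Singular values with index at least the dimension are 0 by convention.
  have hfin : 1 < Module.finrank ℝ E := by
    by_contra! hf
    rw [T.singularValues_of_finrank_le hf] at h
    linarith
  have h0 : 1 ≤ T.singularValues 0 := h.trans (T.singularValues_antitone zero_le_one)
  let e := T.isSymmetric_adjoint_comp_self.eigenvectorBasis rfl
  have key : ∀ i : Fin (Module.finrank ℝ E), 1 ≤ T.singularValues i → ∃ c : ℝ, e i = c • w := by
    intro i hi
    refine heq _ (le_antisymm (hle _) ?_)
    have h1 : ‖T (e i)‖ ^ 2 = T.singularValues i ^ 2 := by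
      rw [T.sq_singularValues_fin rfl i, ← real_inner_self_eq_norm_sq,
        ← LinearMap.adjoint_inner_right]
      have := T.isSymmetric_adjoint_comp_self.apply_eigenvectorBasis rfl i
      rw [LinearMap.comp_apply] at this
      rw [show e i = T.isSymmetric_adjoint_comp_self.eigenvectorBasis rfl i from rfl, this,
        inner_smul_right, real_inner_self_eq_norm_sq, OrthonormalBasis.norm_eq_one]
      simp
    rw [e.norm_eq_one]
    nlinarith [norm_nonneg (T (e i))]
  obtain ⟨c, hc⟩ := key ⟨0, by omega⟩ h0
  obtain ⟨d, hd⟩ := key ⟨1, hfin⟩ h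
  have hn0 := e.norm_eq_one ⟨0, by omega⟩
  have hn1 := e.norm_eq_one ⟨1, hfin⟩
  have ho := e.orthonormal.2 (show (⟨0, by omega⟩ : Fin (Module.finrank ℝ E)) ≠ ⟨1, hfin⟩ by simp)
  simp only at ho
  rw [hc, hd, inner_smul_left, inner_smul_right, real_inner_self_eq_norm_sq] at ho
  rw [hc, norm_smul] at hn0
  rw [hd, norm_smul] at hn1
  have hw : ‖w‖ ≠ 0 := fun h => by simp [h] at hn0
  have hc0 : c ≠ 0 := fun h => by simp [h] at hn0
  have hd0 : d ≠ 0 := fun h => by simp [h] at hn1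
  simp_all

/-! ### Phases and magnitude retrieval. -/

theorem phase_mul_norm (z : ℂ) : phase z * (‖z‖ : ℂ) = z := by
  by_cases h : z = 0
  · simp [h, phase]
  · have : (‖z‖ : ℂ) ≠ 0 := by simpa using h
    rw [phase]; field_simp

theorem norm_phase {z : ℂ} (h : z ≠ 0) : ‖phase z‖ = 1 := by
  simp [phase, h]

theorem phase_mul {c z : ℂ} : phase (c * z) = phase c * phase z := by
  simp [phase, mul_div_mul_comm]

theorem phase_of_norm_eq_one {c : ℂ} (h : ‖c‖ = 1) : phase c = c := by
  simp [phase, h]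

theorem phase_real_mul_of_ne_zero {r : ℝ} {u : ℂ} (hr : r ≠ 0) (hu : ‖u‖ = 1) :
    phase (r * u) = u ∨ phase (r * u) = -u := by
  rw [phase_mul, phase_of_norm_eq_one hu]
  rcases lt_or_gt_of_ne hr with h | h
  · right
    have : (r : ℂ) ≠ 0 := by exact_mod_cast hr
    simp [phase, abs_of_neg h, this]
  · left
    have : (r : ℂ) ≠ 0 := by exact_mod_cast hr
    simp [phase, abs_of_pos h, this]

variable {n m : ℕ} {A : Matrix (Fin n) (Fin m) ℂ} {xs : EuclideanSpace ℂ (Fin n)}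

/-- Vectors all of whose measurements are real multiples of those of `xs`, zero included, are
real multiples of `xs`. -/
theorem MagnitudeRetrievalUnique.eq_smul (hmag : MagnitudeRetrievalUnique A xs)
    (h0 : ∀ i, meas A xs i ≠ 0) (x : EuclideanSpace ℂ (Fin n)) (r : Fin m → ℝ)
    (hr : ∀ i, meas A x i = r i * phase (meas A xs i)) : ∃ c : ℝ, x = (c : ℂ) • xs := by
  -- A vanishing measurement has phase 0, which the uniqueness hypothesis does not allow. Adding `s
  -- • xs` makes all measurements nonzero, since only finitely many `s` are bad.
  obtain ⟨s, hs⟩ : ∃ s : ℝ, ∀ i, r i + s * ‖meas A xs i‖ ≠ 0 := by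
    obtain ⟨s, hs⟩ := ((Set.finite_range fun i => -(r i) / ‖meas A xs i‖).infinite_compl).nonempty
    refine ⟨s, fun i hi => hs ⟨i, ?_⟩⟩
    have : ‖meas A xs i‖ ≠ 0 := by simpa using h0 i
    simp only
    rw [div_eq_iff this]
    linarith
  obtain ⟨c, -, hc⟩ := hmag (x + (s : ℂ) • xs) fun i => by
    have : meas A (x + (s : ℂ) • xs) i
        = ((r i + s * ‖meas A xs i‖ : ℝ) : ℂ) * phase (meas A xs i) := by
      rw [map_add, map_smul, PiLp.add_apply, PiLp.smul_apply, hr, smul_eq_mul]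
      conv_lhs => rw [← phase_mul_norm (meas A xs i)]
      rw [phase_mul, phase_of_norm_eq_one (norm_phase (h0 i))]
      have : phase (‖meas A xs i‖ : ℂ) = 1 := by
        have : (‖meas A xs i‖ : ℂ) ≠ 0 := by simpa using h0 i
        simp [phase, this]
      rw [this]
      push_cast
      ring
    rw [this]
    exact phase_real_mul_of_ne_zero (hs i) (norm_phase (h0 i))
  refine ⟨c - s, ?_⟩
  push_cast
  rw [sub_smul, ← hc, add_sub_cancel_right]

theorem meas_ne_zero_of_norm_eq {b : Fin m → ℝ} (hxs : ∀ i, ‖meas A xs i‖ = b i)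
    (hb : ∀ i, 0 < b i) (i : Fin m) : meas A xs i ≠ 0 :=
  norm_pos_iff.1 (hxs i ▸ hb i)

/-! ### Bounds for `σ₂`, `δ₁`, `β̃` and `t_max`. -/

open scoped ComplexOrder in
theorem matC_mul_conjTranspose {L : Matrix (Fin n) (Fin n) ℂ} (hL : L * Lᴴ = 1 + A * Aᴴ) :
    matC A L * (matC A L)ᴴ = 1 := by
  have hpd : (L * Lᴴ).PosDef := by
    rw [hL]
    exact Matrix.PosDef.one.add_posSemidef (Matrix.posSemidef_self_mul_conjTranspose A)
  have hu : IsUnit L.det := by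
    have := hpd.isUnit
    rw [Matrix.isUnit_iff_isUnit_det, Matrix.det_mul] at this
    exact isUnit_of_mul_isUnit_left this
  have hu' : IsUnit Lᴴ.det := by rw [Matrix.det_conjTranspose]; exact hu.star
  rw [matC, Matrix.conjTranspose_fromCols_eq_fromRows_conjTranspose, Matrix.fromCols_mul_fromRows,
    Matrix.conjTranspose_mul, Matrix.conjTranspose_nonsing_inv, Matrix.mul_assoc,
    ← Matrix.mul_assoc A, ← Matrix.mul_add,
    show (Lᴴ)⁻¹ + A * Aᴴ * (Lᴴ)⁻¹ = (1 + A * Aᴴ) * (Lᴴ)⁻¹ by rw [Matrix.add_mul, Matrix.one_mul],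
    ← hL, Matrix.mul_assoc, Matrix.mul_nonsing_inv _ hu', Matrix.mul_one,
    Matrix.nonsing_inv_mul _ hu]

/-- The vector `Ω w`, for a real vector `w`. -/
noncomputable def rotate (A : Matrix (Fin n) (Fin m) ℂ) (xs : EuclideanSpace ℂ (Fin n)) (ωx : Fin n → ℂ)
    (w : EuclideanSpace ℝ (Fin n ⊕ Fin m)) : EuclideanSpace ℂ (Fin n ⊕ Fin m) :=
  WithLp.toLp 2 fun i => Sum.elim ωx (fun i => phase (meas A xs i)) i * (w i : ℂ)

theorem norm_rotate {ωx : Fin n → ℂ} (hω : ∀ j, ‖ωx j‖ = 1) (h0 : ∀ i, meas A xs i ≠ 0)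
    (w : EuclideanSpace ℝ (Fin n ⊕ Fin m)) : ‖rotate A xs ωx w‖ = ‖w‖ := by
  rw [EuclideanSpace.norm_eq, EuclideanSpace.norm_eq]
  congr 1
  refine Finset.sum_congr rfl fun i _ => ?_
  rcases i with i | i
  · simp [rotate, hω]
  · simp [rotate, norm_phase (h0 i)]

/-- On a real vector `w`, the real form of `B` lists the real and imaginary parts of `B w = C Ω w`.
-/
theorem norm_realB_apply (L : Matrix (Fin n) (Fin n) ℂ) (ωx : Fin n → ℂ)
    (w : EuclideanSpace ℝ (Fin n ⊕ Fin m)) :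
    ‖Matrix.toEuclideanLin (realB A L xs ωx) w‖
      = ‖Matrix.toEuclideanLin (matC A L) (rotate A xs ωx w)‖ := by
  rw [EuclideanSpace.norm_eq, EuclideanSpace.norm_eq, Fintype.sum_sum_type,
    ← Finset.sum_add_distrib]
  congr 1
  refine Finset.sum_congr rfl fun i _ => ?_
  have key : Matrix.toEuclideanLin (matC A L) (rotate A xs ωx w) i
      = ∑ j, matB A L xs ωx i j * (w j : ℂ) := by
    simp only [Matrix.toLpLin_apply, Matrix.mulVec, dotProduct, rotate, matB,
      Matrix.mul_diagonal]
    exact Finset.sum_congr rfl fun j _ => by ring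
  rw [key, ← Complex.normSq_eq_norm_sq, Complex.normSq_apply, Complex.re_sum, Complex.im_sum]
  simp [Matrix.toLpLin_apply, Matrix.mulVec, dotProduct, realB, sq]

theorem sigma2_lt_one {ωx : Fin n → ℂ} (hmag : MagnitudeRetrievalUnique A xs)
    (h0 : ∀ i, meas A xs i ≠ 0) {L : Matrix (Fin n) (Fin n) ℂ} (hL : L * Lᴴ = 1 + A * Aᴴ)
    (hω : ∀ j, ‖ωx j‖ = 1 ∧ xs j = (‖xs j‖ : ℂ) * ωx j) : sigma2 A L xs ωx < 1 := by
  set S := Matrix.toEuclideanLin (matC A L) with hSdef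
  have hadj : S.adjoint = Matrix.toEuclideanLin (matC A L)ᴴ :=
    (Matrix.toEuclideanLin_conjTranspose_eq_adjoint _).symm
  have hS : ∀ v, S (S.adjoint v) = v := by
    intro v
    rw [hadj, hSdef]
    ext i
    simp [Matrix.toLpLin_apply, Matrix.mulVec_mulVec, matC_mul_conjTranspose hL]
  have hrot := norm_rotate (A := A) (xs := xs) (fun j => (hω j).1) h0
  -- The extremal direction is `|z♮|`, because `Ω |z♮| = z♮`.
  refine singularValues_one_lt_one _
    (WithLp.toLp 2 (Sum.elim (fun j => ‖xs j‖) fun i => ‖meas A xs i‖)) (fun w => ?_) fun w hw => ?_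
  · rw [norm_realB_apply, ← hrot w]
    have := norm_sq_add_norm_sub_sq_of_coisometry S hS (rotate A xs ωx w)
    refine le_of_sq_le_sq ?_ (norm_nonneg _)
    rw [← this]
    exact le_add_of_nonneg_right (sq_nonneg _)
  · rw [norm_realB_apply, ← hrot w] at hw
    have := norm_sq_add_norm_sub_sq_of_coisometry S hS (rotate A xs ωx w)
    rw [← hSdef] at hw
    rw [hw] at this
    -- Equality in the Pythagorean identity puts `Ω w` in the range of `C*`, which consists of the
    -- graph points `(x, A* x)` with `x = (L⁻¹)* v`.
    have hz : rotate A xs ωx w = S.adjoint (S (rotate A xs ωx w)) := by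
      rw [← sub_eq_zero, ← norm_eq_zero, ← sq_eq_zero_iff]
      linarith
    set v := S (rotate A xs ωx w)
    set x : EuclideanSpace ℂ (Fin n) := Matrix.toEuclideanLin (L⁻¹)ᴴ v with hx
    have hfst : ∀ j, x j = ωx j * (w (Sum.inl j) : ℂ) := by
      intro j
      have := congrArg (fun u : EuclideanSpace ℂ (Fin n ⊕ Fin m) => u (Sum.inl j)) hz
      simp only [hadj, rotate, matC, Matrix.toLpLin_apply,
        Matrix.conjTranspose_fromCols_eq_fromRows_conjTranspose, Matrix.fromRows_mulVec,
        Sum.elim_inl] at this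
      rw [this, hx, Matrix.toLpLin_apply]
    have hsnd : ∀ i, meas A x i = (w (Sum.inr i) : ℂ) * phase (meas A xs i) := by
      intro i
      have := congrArg (fun u : EuclideanSpace ℂ (Fin n ⊕ Fin m) => u (Sum.inr i)) hz
      simp only [hadj, rotate, matC, Matrix.toLpLin_apply,
        Matrix.conjTranspose_fromCols_eq_fromRows_conjTranspose, Matrix.fromRows_mulVec,
        Sum.elim_inr, Matrix.conjTranspose_mul, ← Matrix.mulVec_mulVec] at this
      rw [mul_comm, this, meas, hx, Matrix.toLpLin_apply, Matrix.toLpLin_apply]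
    obtain ⟨c, hc⟩ := hmag.eq_smul h0 x _ hsnd
    refine ⟨c, ?_⟩
    ext i
    rcases i with j | i
    · have h1 := hfst j
      have hne : ωx j ≠ 0 := fun h => by simpa [h] using (hω j).1
      rw [hc, PiLp.smul_apply, smul_eq_mul, (hω j).2] at h1
      have : (w (Sum.inl j) : ℂ) = c * ‖xs j‖ := mul_left_cancel₀ hne (by rw [← h1]; ring)
      simpa using (by exact_mod_cast this : w (Sum.inl j) = c * ‖xs j‖)
    · have h1 := hsnd i
      have hne : phase (meas A xs i) ≠ 0 := fun h => by simpa [h] using norm_phase (h0 i)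
      rw [hc, map_smul, PiLp.smul_apply, smul_eq_mul, ← phase_mul_norm (meas A xs i),
        phase_mul, phase_of_norm_eq_one (norm_phase (h0 i))] at h1
      have hp : phase (‖meas A xs i‖ : ℂ) = 1 := by
        have : (‖meas A xs i‖ : ℂ) ≠ 0 := by simpa using h0 i
        simp [phase, this]
      rw [hp, mul_one] at h1
      have : (w (Sum.inr i) : ℂ) = c * ‖meas A xs i‖ := mul_left_cancel₀ hne (by
        rw [mul_comm, ← h1]; ring)
      simpa using (by exact_mod_cast this : w (Sum.inr i) = c * ‖meas A xs i‖)

/-- The real infimum of an empty set is 0, so some nonzero singular value must exist: injectivity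
and `0 < n` force `A ≠ 0`. The set is finite, so the infimum is attained. -/
theorem sMin_pos (hn : 0 < n) (hA : Function.Injective (meas A)) : 0 < sMin A := by
  set S : Set ℝ := {s : ℝ | s ≠ 0 ∧ ∃ i : ℕ, s = (Matrix.toEuclideanLin A).singularValues i}
  have hfin : S.Finite := by
    refine ((Matrix.toEuclideanLin A).singularValues.support.finite_toSet.image
      (Matrix.toEuclideanLin A).singularValues).subset ?_
    rintro s ⟨hs, i, rfl⟩
    exact ⟨i, by simpa only [Finset.mem_coe, Finsupp.mem_support_iff] using hs, rfl⟩
  have hne : S.Nonempty := by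
    by_contra hS
    have hz : (Matrix.toEuclideanLin A).singularValues = 0 := by
      ext i
      by_contra hi
      exact hS ⟨_, hi, i, rfl⟩
    rw [LinearMap.singularValues_eq_zero_iff, map_eq_zero_iff _ (LinearEquiv.injective _)] at hz
    have : meas A (EuclideanSpace.single ⟨0, hn⟩ 1) = meas A 0 := by simp [meas, hz]
    have := congrArg (fun v : EuclideanSpace ℂ (Fin n) => v ⟨0, hn⟩) (hA this)
    simp at this
  obtain ⟨hs, i, hi⟩ := hne.csInf_mem hfin
  refine lt_of_le_of_ne ?_ (Ne.symm hs)
  rw [sMin, hi]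
  exact LinearMap.singularValues_nonneg _ i

theorem delta1_mem_Ioo (h : 0 < sMin A) : delta1 A ∈ Set.Ioo 0 1 := by
  have h1 : 1 < √(1 + sMin A ^ 2) := Real.lt_sqrt_of_sq_lt (by nlinarith)
  exact ⟨by unfold delta1; positivity, by rw [delta1, div_lt_one (by linarith)]; exact h1⟩

/-- The first entry of the maximum equals `1 - (1 - σ₂²) (1 - δ₁²)`. -/
theorem betaTilde_mem_Ioo {L : Matrix (Fin n) (Fin n) ℂ} {ωx : Fin n → ℂ}
    (hσ : sigma2 A L xs ωx < 1) (hδ : delta1 A ∈ Set.Ioo 0 1) :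
    betaTilde A L xs ωx ∈ Set.Ioo 0 1 := by
  have h0 : 0 ≤ sigma2 A L xs ωx := LinearMap.singularValues_nonneg _ 1
  have h1 : sigma2 A L xs ωx ^ 2 < 1 := by nlinarith
  have h2 : 0 < delta1 A ^ 2 := pow_pos hδ.1 2
  have h3 : delta1 A ^ 2 < 1 := by nlinarith [hδ.1, hδ.2]
  constructor
  · exact Real.sqrt_pos.2 (lt_max_of_lt_left (by nlinarith [sq_nonneg (sigma2 A L xs ωx)]))
  · rw [betaTilde, Real.sqrt_lt' one_pos]
    exact max_lt (by nlinarith) (by linarith)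

theorem tMax_mem_Ioo {β : ℝ} (hβ : β ∈ Set.Ioo (0 : ℝ) 1) : tMax β ∈ Set.Ioo 0 1 := by
  have h1 : 0 < β ^ 2 := pow_pos hβ.1 2
  have h2 : β ^ 2 < 1 := by nlinarith [hβ.1, hβ.2]
  exact ⟨div_pos (by linarith) (by linarith), by rw [tMax, div_lt_one (by linarith)]; linarith⟩

/-! ### Distance modulo a global phase. -/

/-- Minimising the distance means maximising `Re (α ⟪u, v⟫)`, which makes `α ⟪u, v⟫` real. The
vanishing imaginary part says that the error is real-orthogonal to the orbit direction `i α v`. -/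
theorem exists_phaseDist_eq {E : Type*} [NormedAddCommGroup E] [InnerProductSpace ℂ E] (u v : E) :
    ∃ α : Circle, phaseDist u v = ‖u - (α : ℂ) • v‖ ∧
      (inner ℂ ((α : ℂ) • v) (u - (α : ℂ) • v)).im = 0 := by
  obtain ⟨α, -, hmin⟩ := isCompact_univ.exists_isMinOn Set.univ_nonempty
    (f := fun α : Circle => ‖u - (α : ℂ) • v‖) (by fun_prop)
  have hα : ∀ β : Circle, ‖u - (α : ℂ) • v‖ ≤ ‖u - (β : ℂ) • v‖ := fun β => hmin (Set.mem_univ β)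
  refine ⟨α, le_antisymm (ciInf_le ⟨0, by rintro _ ⟨_, rfl⟩; exact norm_nonneg _⟩ α)
    (le_ciInf hα), ?_⟩
  have hsq : ∀ β : Circle, ‖u - (β : ℂ) • v‖ ^ 2
      = ‖u‖ ^ 2 - 2 * ((β : ℂ) * inner ℂ u v).re + ‖v‖ ^ 2 := by
    intro β
    rw [@norm_sub_sq ℂ, inner_smul_right, norm_smul, Circle.norm_coe, one_mul]
    rfl
  set c : ℂ := inner ℂ u v with hc
  have hmax : ∀ β : Circle, ((β : ℂ) * c).re ≤ ((α : ℂ) * c).re := by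
    intro β
    have := pow_le_pow_left₀ (norm_nonneg _) (hα β) 2
    rw [hsq, hsq] at this
    linarith
  have him : ((α : ℂ) * c).im = 0 := by
    by_cases h0 : c = 0
    · simp [h0]
    have hn : (‖c‖ : ℂ) ≠ 0 := by simpa using h0
    -- This phase turns `c` into `‖c‖`, so the maximal real part is at least the modulus and leaves
    -- no imaginary part.
    have h2 := hmax ⟨starRingEnd ℂ c / ‖c‖, by simp [Submonoid.unitSphere, h0]⟩
    have h3 : ((starRingEnd ℂ c / ‖c‖ : ℂ) * c).re = ‖c‖ := by
      rw [div_mul_eq_mul_div, ← Complex.normSq_eq_conj_mul_self, Complex.normSq_eq_norm_sq]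
      push_cast
      rw [sq, mul_div_cancel_right₀ _ hn, Complex.ofReal_re]
    have h4 : ‖(α : ℂ) * c‖ = ‖c‖ := by rw [norm_mul, Circle.norm_coe, one_mul]
    change ((starRingEnd ℂ c / ‖c‖ : ℂ) * c).re ≤ _ at h2
    rw [h3, ← h4] at h2
    have h5 := Complex.normSq_apply ((α : ℂ) * c)
    rw [Complex.normSq_eq_norm_sq] at h5
    nlinarith [norm_nonneg ((α : ℂ) * c), mul_self_nonneg (((α : ℂ) * c).im)]
  have hconj : inner ℂ ((α : ℂ) • v) u = starRingEnd ℂ ((α : ℂ) * c) := by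
    rw [← inner_conj_symm, inner_smul_right]
  rw [inner_sub_right, hconj, inner_self_eq_norm_sq_to_K, Complex.sub_im, Complex.conj_im, him,
    RCLike.ofReal_eq_complex_ofReal, ← Complex.ofReal_pow, Complex.ofReal_im]
  simp

theorem phaseDist_le {E : Type*} [NormedAddCommGroup E] [Module ℂ E] (u v : E) (α : Circle) :
    phaseDist u v ≤ ‖u - (α : ℂ) • v‖ :=
  ciInf_le (f := fun α : Circle => ‖u - (α : ℂ) • v‖)
    ⟨0, by rintro _ ⟨_, rfl⟩; exact norm_nonneg _⟩ α

theorem phaseDist_nonneg {E : Type*} [NormedAddCommGroup E] [Module ℂ E] (u v : E) :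
    0 ≤ phaseDist u v :=
  Real.iInf_nonneg fun _ => norm_nonneg _

/-! ### Norm estimates for the linearised iteration. -/

section Linearization

variable {H : Type*} [NormedAddCommGroup H] [InnerProductSpace ℂ H]

theorem norm_add_sq_of_inner_eq_zero {u v : H} (h : inner ℂ u v = 0) :
    ‖u + v‖ ^ 2 = ‖u‖ ^ 2 + ‖v‖ ^ 2 := by
  rw [@norm_add_sq ℂ, h]
  simp

theorem norm_sq_eq_starProjection_add (K : Submodule ℂ H) [K.HasOrthogonalProjection] (u : H) :
    ‖u‖ ^ 2 = ‖K.starProjection u‖ ^ 2 + ‖u - K.starProjection u‖ ^ 2 := by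
  rw [← norm_add_sq_of_inner_eq_zero, add_sub_cancel]
  rw [inner_eq_zero_symm]
  exact K.starProjection_inner_eq_zero u _ (K.starProjection_apply_mem u)

/-- The linearised iteration does not increase the norm of `q + p` for orthogonal `q` and `p`, and
preserves it only if `p = 0` and `q` lies in the subspace `K`. -/
theorem eq_zero_and_mem_of_norm_le_relaxed (K : Submodule ℂ H) [K.HasOrthogonalProjection] {t : ℝ}
    (ht0 : 0 < t) (ht1 : t < 1) (q p : H)
    (h : ‖q‖ ^ 2 + ‖p‖ ^ 2 ≤
      ‖p + ((t : ℂ) • (q - p) + ((1 - t : ℝ) : ℂ) • K.starProjection (q - p))‖ ^ 2) :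
    p = 0 ∧ q ∈ K := by
  set a := q - K.starProjection q with ha
  set e := p - K.starProjection p with he
  have hw : p + ((t : ℂ) • (q - p) + ((1 - t : ℝ) : ℂ) • K.starProjection (q - p))
      = K.starProjection q + ((t : ℂ) • a + ((1 - t : ℝ) : ℂ) • e) := by
    rw [ha, he, map_sub]
    push_cast
    module
  have hpy : ‖K.starProjection q + ((t : ℂ) • a + ((1 - t : ℝ) : ℂ) • e)‖ ^ 2
      = ‖K.starProjection q‖ ^ 2 + ‖(t : ℂ) • a + ((1 - t : ℝ) : ℂ) • e‖ ^ 2 := by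
    refine norm_add_sq_of_inner_eq_zero ?_
    rw [inner_eq_zero_symm, inner_add_left, inner_smul_left, inner_smul_left,
      K.starProjection_inner_eq_zero q _ (K.starProjection_apply_mem q),
      K.starProjection_inner_eq_zero p _ (K.starProjection_apply_mem q)]
    simp
  have hle : ‖(t : ℂ) • a + ((1 - t : ℝ) : ℂ) • e‖ ≤ t * ‖a‖ + (1 - t) * ‖e‖ := by
    refine (norm_add_le _ _).trans_eq ?_
    rw [norm_smul, norm_smul, Complex.norm_real, Complex.norm_real, Real.norm_of_nonneg ht0.le,
      Real.norm_of_nonneg (by linarith)]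
  have hsq := pow_le_pow_left₀ (norm_nonneg _) hle 2
  have hq := norm_sq_eq_starProjection_add K q
  have hp := norm_sq_eq_starProjection_add K p
  rw [hw, hpy] at h
  rw [← ha] at hq
  rw [← he] at hp
  have hconv : (t * ‖a‖ + (1 - t) * ‖e‖) ^ 2 ≤ t * ‖a‖ ^ 2 + (1 - t) * ‖e‖ ^ 2 := by
    nlinarith [mul_nonneg (mul_pos ht0 (sub_pos.2 ht1)).le (sq_nonneg (‖a‖ - ‖e‖))]
  have hE : ‖e‖ ^ 2 ≤ ‖p‖ ^ 2 := by nlinarith [sq_nonneg ‖K.starProjection p‖]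
  -- Insert convexity of the square and `‖e‖ ≤ ‖p‖` into `h`, then cancel `‖Π q‖²`, with `Π` the
  -- projection onto `K`.
  have hfin : (1 - t) * ‖a‖ ^ 2 + t * ‖p‖ ^ 2 ≤ 0 := by nlinarith
  have ha0 : ‖a‖ ^ 2 = 0 := by
    nlinarith [sq_nonneg ‖a‖, mul_nonneg ht0.le (sq_nonneg ‖p‖)]
  have hp0 : ‖p‖ ^ 2 = 0 := by
    nlinarith [sq_nonneg ‖p‖, mul_nonneg (sub_pos.2 ht1).le (sq_nonneg ‖a‖)]
  refine ⟨by simpa using hp0, K.starProjection_eq_self_iff.1 ?_⟩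
  exact (sub_eq_zero.1 (by simpa using ha0 : a = 0)).symm

/-- A real-linear map that strictly decreases norms on the real hyperplane `Im ⟪w, v⟫ = 0` does so
uniformly. -/
theorem exists_norm_le_mul_of_norm_lt [FiniteDimensional ℂ H] (M : H →L[ℝ] H) (w : H)
    (h : ∀ v, v ≠ 0 → (inner ℂ w v).im = 0 → ‖M v‖ < ‖v‖) :
    ∃ g : ℝ, 0 ≤ g ∧ g < 1 ∧ ∀ v, (inner ℂ w v).im = 0 → ‖M v‖ ≤ g * ‖v‖ := by
  have : ProperSpace H := FiniteDimensional.proper ℂ H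
  set C : Set H := Metric.sphere 0 1 ∩ {v | (inner ℂ w v).im = 0} with hC
  have hcomp : IsCompact C := (isCompact_sphere 0 1).inter_right
    (isClosed_eq (by fun_prop) continuous_const)
  have hscale : ∀ v : H, v ≠ 0 → (inner ℂ w v).im = 0 → ‖v‖⁻¹ • v ∈ C := by
    intro v hv hi
    refine ⟨by simp [norm_smul, hv], ?_⟩
    have : ‖v‖⁻¹ • v = ((‖v‖⁻¹ : ℝ) : ℂ) • v := rfl
    change (inner ℂ w (‖v‖⁻¹ • v)).im = 0
    rw [this, inner_smul_right, Complex.im_ofReal_mul, hi, mul_zero]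
  -- `C` is empty exactly when the hyperplane is zero, and then any factor works.
  rcases C.eq_empty_or_nonempty with he | hne
  · refine ⟨0, le_rfl, one_pos, fun v hi => ?_⟩
    by_cases hv : v = 0
    · simp [hv]
    · exact absurd (hscale v hv hi) (he ▸ Set.notMem_empty _)
  · obtain ⟨v₀, hv₀, hmax⟩ := hcomp.exists_isMaxOn hne (f := fun v => ‖M v‖) (by fun_prop)
    have hn₀ : ‖v₀‖ = 1 := by simpa using hv₀.1
    refine ⟨‖M v₀‖, norm_nonneg _, ?_, fun v hi => ?_⟩
    · rw [← hn₀]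
      exact h v₀ (norm_ne_zero_iff.1 (by simp [hn₀])) hv₀.2
    · by_cases hv : v = 0
      · simp [hv]
      have h1 : ‖M (‖v‖⁻¹ • v)‖ ≤ ‖M v₀‖ := hmax (hscale v hv hi)
      rw [map_smul, norm_smul, norm_inv, norm_norm, inv_mul_le_iff₀ (norm_pos_iff.2 hv)] at h1
      rwa [mul_comm]

end Linearization

/-! ### Derivatives of the prox and of the iteration map. -/

/-- The real-linear projection of `ℂ` along the real line spanned by the unit number `u`. -/
noncomputable def tangentProj (u : ℂ) : ℂ →L[ℝ] ℂ :=
  ContinuousLinearMap.id ℝ ℂ - (innerSL ℝ u).smulRight u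

theorem tangentProj_apply (u v : ℂ) : tangentProj u v = v - ((inner ℝ u v : ℝ) : ℂ) * u := by
  simp [tangentProj]

theorem norm_tangentProj_sq_add {u : ℂ} (hu : ‖u‖ = 1) (v : ℂ) :
    ‖tangentProj u v‖ ^ 2 + ‖v - tangentProj u v‖ ^ 2 = ‖v‖ ^ 2 := by
  have h : inner ℝ (tangentProj u v) (v - tangentProj u v) = 0 := by
    rw [tangentProj_apply, sub_sub_cancel, ← Complex.real_smul, inner_smul_right, inner_sub_left,
      inner_smul_left, real_inner_self_eq_norm_sq, hu, real_inner_comm]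
    simp
  have := norm_add_sq_real (tangentProj u v) (v - tangentProj u v)
  rw [h, add_sub_cancel] at this
  linarith

/-- Radial motion leaves the phase unchanged; at radius `‖y‖` tangential motion passes through with
factor 1. Hence the derivative is an orthogonal projection when `b = |y|`. -/
theorem hasFDerivAt_phase {y : ℂ} (hy : y ≠ 0) :
    HasFDerivAt (fun z => (‖y‖ : ℂ) * phase z) (tangentProj (phase y)) y := by
  have hn : ‖y‖ ≠ 0 := norm_ne_zero_iff.2 hy
  have h1 : HasFDerivAt (fun z : ℂ => ‖z‖) ((1 / (2 * ‖y‖)) • (2 • innerSL ℝ y)) y := by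
    have := (hasStrictFDerivAt_norm_sq y).hasFDerivAt.sqrt (by positivity)
    simpa [Real.sqrt_sq (norm_nonneg _)] using this
  have h2 := ((((hasDerivAt_inv hn).comp_hasFDerivAt y h1).smul (hasFDerivAt_id y)).const_smul ‖y‖)
  refine (h2.congr_fderiv ?_).congr_of_eventuallyEq (.of_forall fun z => ?_)
  · ext v
    have hn' : (‖y‖ : ℂ) ≠ 0 := by exact_mod_cast hn
    simp [tangentProj_apply, phase]
    field_simp
    ring
  · simp [phase, div_eq_inv_mul]

variable {b : Fin m → ℝ}

/-- The derivative of `proxF` at a point with entries of phases `u`. -/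
noncomputable def tangentProjF (u : Fin m → ℂ) :
    EuclideanSpace ℂ (Fin m) →L[ℝ] EuclideanSpace ℂ (Fin m) :=
  (PiLp.continuousLinearEquiv 2 ℝ fun _ : Fin m => ℂ).symm.toContinuousLinearMap ∘L
    ContinuousLinearMap.pi fun i => tangentProj (u i) ∘L PiLp.proj 2 (𝕜 := ℝ) (fun _ => ℂ) i

theorem tangentProjF_apply (u : Fin m → ℂ) (v : EuclideanSpace ℂ (Fin m)) (i : Fin m) :
    tangentProjF u v i = tangentProj (u i) (v i) := rfl

/-- The derivative of `proxPhi` at a point whose second component has entries of phases `u`. -/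
noncomputable def tangentProjPhi (n : ℕ) (u : Fin m → ℂ) : Stacked n m →L[ℝ] Stacked n m :=
  (WithLp.prodContinuousLinearEquiv 2 ℝ (EuclideanSpace ℂ (Fin n))
      (EuclideanSpace ℂ (Fin m))).symm.toContinuousLinearMap ∘L
    (ContinuousLinearMap.prodMap (.id ℝ _) (tangentProjF u)) ∘L
    (WithLp.prodContinuousLinearEquiv 2 ℝ (EuclideanSpace ℂ (Fin n))
      (EuclideanSpace ℂ (Fin m))).toContinuousLinearMap

theorem tangentProjPhi_apply (u : Fin m → ℂ) (v : Stacked n m) :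
    tangentProjPhi n u v = stack v.fst (tangentProjF u v.snd) := rfl

theorem norm_tangentProjPhi_sq_add {u : Fin m → ℂ} (hu : ∀ i, ‖u i‖ = 1) (v : Stacked n m) :
    ‖tangentProjPhi n u v‖ ^ 2 + ‖v - tangentProjPhi n u v‖ ^ 2 = ‖v‖ ^ 2 := by
  rw [tangentProjPhi_apply, WithLp.prod_norm_sq_eq_of_L2, WithLp.prod_norm_sq_eq_of_L2,
    WithLp.prod_norm_sq_eq_of_L2]
  have : ‖tangentProjF u v.snd‖ ^ 2 + ‖v.snd - tangentProjF u v.snd‖ ^ 2 = ‖v.snd‖ ^ 2 := by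
    rw [EuclideanSpace.norm_sq_eq, EuclideanSpace.norm_sq_eq, EuclideanSpace.norm_sq_eq,
      ← Finset.sum_add_distrib]
    exact Finset.sum_congr rfl fun i _ => norm_tangentProj_sq_add (hu i) _
  simp
  linarith

theorem hasFDerivAt_proxF {y : EuclideanSpace ℂ (Fin m)} (hy : ∀ i, y i ≠ 0)
    (hb : ∀ i, ‖y i‖ = b i) :
    HasFDerivAt (proxF b) (tangentProjF fun i => phase (y i)) y := by
  refine ((PiLp.continuousLinearEquiv 2 ℝ fun _ : Fin m => ℂ).symm.hasFDerivAt).comp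
    (f := fun z : EuclideanSpace ℂ (Fin m) => fun i => (b i : ℂ) * phase (z i)) y ?_
  rw [hasFDerivAt_pi]
  intro i
  have h := hasFDerivAt_phase (hy i)
  rw [hb i] at h
  exact HasFDerivAt.comp (g := fun z : ℂ => (b i : ℂ) * phase z) (f := fun z => z.ofLp i) y h
    (PiLp.proj 2 (𝕜 := ℝ) (fun _ : Fin m => ℂ) i).hasFDerivAt

theorem hasFDerivAt_proxPhi {z : Stacked n m} (hy : ∀ i, z.snd i ≠ 0)
    (hb : ∀ i, ‖z.snd i‖ = b i) :
    HasFDerivAt (proxPhi b) (tangentProjPhi n fun i => phase (z.snd i)) z := by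
  let e := WithLp.prodContinuousLinearEquiv 2 ℝ (EuclideanSpace ℂ (Fin n))
    (EuclideanSpace ℂ (Fin m))
  have h : HasFDerivAt (Prod.map id (proxF b)) (ContinuousLinearMap.prodMap (.id ℝ _)
      (tangentProjF fun i => phase (z.snd i))) (e z) :=
    HasFDerivAt.prodMap (e z) (hasFDerivAt_id _) (hasFDerivAt_proxF hy hb)
  exact e.symm.hasFDerivAt.comp z (h.comp z e.hasFDerivAt)

/-- The robust graph projection as a continuous linear map. -/
noncomputable def robustProjL (A : Matrix (Fin n) (Fin m) ℂ) (t : ℝ) :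
    Stacked n m →L[ℝ] Stacked n m :=
  ((t : ℂ) • ContinuousLinearMap.id ℂ _ + ((1 - t : ℝ) : ℂ) • graphProj A).restrictScalars ℝ

theorem hasFDerivAt_rgpsDRStep {z : Stacked n m} (hy : ∀ i, z.snd i ≠ 0)
    (hb : ∀ i, ‖z.snd i‖ = b i) (t : ℝ) :
    HasFDerivAt (rgpsDRStep A b t)
      (.id ℝ _ + robustProjL A t ∘L ((2 : ℝ) • (tangentProjPhi n fun i => phase (z.snd i)) -
        .id ℝ _) - tangentProjPhi n fun i => phase (z.snd i)) z := by
  have hP := hasFDerivAt_proxPhi hy hb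
  exact ((hasFDerivAt_id z).add ((robustProjL A t).hasFDerivAt.comp z
    ((hP.const_smul (2 : ℝ)).sub (hasFDerivAt_id z)))).sub hP

/-! ### Strict contraction transversally to the phase orbit. -/

theorem norm_rgpsDRStep_deriv_lt (hmag : MagnitudeRetrievalUnique A xs)
    (h0 : ∀ i, meas A xs i ≠ 0) {t : ℝ} (ht0 : 0 < t) (ht1 : t < 1) {v : Stacked n m}
    (hv : v ≠ 0) (him : (inner ℂ (stack xs (meas A xs)) v).im = 0) :
    ‖((.id ℝ _ + robustProjL A t ∘L ((2 : ℝ) • (tangentProjPhi n fun i => phase (meas A xs i)) -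
        .id ℝ _) - tangentProjPhi n fun i => phase (meas A xs i)) : Stacked n m →L[ℝ] _) v‖
      < ‖v‖ := by
  set Q := tangentProjPhi n fun i => phase (meas A xs i) with hQ
  have hrw : ((.id ℝ _ + robustProjL A t ∘L ((2 : ℝ) • Q - .id ℝ _) - Q) : Stacked n m →L[ℝ] _) v
      = (v - Q v) + ((t : ℂ) • (Q v - (v - Q v)) +
        ((1 - t : ℝ) : ℂ) • (graphSet A).starProjection (Q v - (v - Q v))) := by
    have : Q v - (v - Q v) = (2 : ℝ) • Q v - v := by module
    rw [this]
    change v + ((t : ℂ) • ((2 : ℝ) • Q v - v) +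
        ((1 - t : ℝ) : ℂ) • (graphSet A).starProjection ((2 : ℝ) • Q v - v)) - Q v = _
    abel
  by_contra! hle
  have hsq := pow_le_pow_left₀ (norm_nonneg _) hle 2
  rw [hrw, ← norm_tangentProjPhi_sq_add (fun i => norm_phase (h0 i)) v] at hsq
  obtain ⟨hp, hq⟩ := eq_zero_and_mem_of_norm_le_relaxed (graphSet A) ht0 ht1 _ _ hsq
  rw [← sub_eq_zero.1 hp] at hq
  have hq : meas A v.fst = v.snd := hq
  have him' : ∀ i, (inner ℝ (phase (meas A xs i)) (v.snd i) : ℝ) = 0 := by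
    intro i
    have h1 : v.snd i = tangentProj (phase (meas A xs i)) (v.snd i) := by
      have := congrArg (fun z : Stacked n m => z.snd i) (sub_eq_zero.1 hp)
      simpa [hQ, tangentProjPhi_apply, tangentProjF_apply] using this
    rw [tangentProj_apply] at h1
    have h2 : ((inner ℝ (phase (meas A xs i)) (v.snd i) : ℝ) : ℂ) * phase (meas A xs i) = 0 := by
      linear_combination h1
    have hne : phase (meas A xs i) ≠ 0 := fun h => by simpa [h] using norm_phase (h0 i)
    exact_mod_cast (mul_eq_zero.1 h2).resolve_right hne
  -- Each `v.snd i` is tangential, an imaginary multiple of the phase of `meas A xs i`.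
  -- Multiplication by `i` makes it a real multiple, as magnitude retrieval requires.
  obtain ⟨c, hc⟩ := hmag.eq_smul h0 (Complex.I • v.fst)
    (fun i => -(starRingEnd ℂ (phase (meas A xs i)) * v.snd i).im) fun i => by
      have hu := norm_phase (h0 i)
      have h2 := him' i
      set u := phase (meas A xs i)
      rw [Complex.inner, mul_comm] at h2
      rw [map_smul, hq, PiLp.smul_apply, smul_eq_mul]
      have h3 : starRingEnd ℂ u * u = 1 := by
        rw [← Complex.normSq_eq_conj_mul_self, Complex.normSq_eq_norm_sq, hu]; simp
      have h4 : starRingEnd ℂ u * v.snd i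
          = ((starRingEnd ℂ u * v.snd i).im : ℂ) * Complex.I := by
        apply Complex.ext
        · rw [Complex.re_ofReal_mul, Complex.I_re, mul_zero]
          exact h2
        · rw [Complex.im_ofReal_mul, Complex.I_im, mul_one]
      calc Complex.I * v.snd i = Complex.I * (starRingEnd ℂ u * v.snd i) * u := by
            linear_combination -Complex.I * v.snd i * h3
        _ = _ := by
            push_cast
            linear_combination Complex.I * u * h4 +
              ((starRingEnd ℂ u * v.snd i).im : ℂ) * u * Complex.I_mul_I
  have hfst : v.fst = (-(c : ℂ) * Complex.I) • xs := by
    rw [mul_comm, ← neg_mul_comm, mul_smul, ← hc, smul_smul]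
    simp
  have hvz : v = (-(c : ℂ) * Complex.I) • stack xs (meas A xs) := by
    apply WithLp.ofLp_injective
    refine Prod.ext hfst ?_
    change v.snd = (-(c : ℂ) * Complex.I) • meas A xs
    rw [← hq, hfst, map_smul]
  -- For `v = -i c z♮` the condition `him` reads `c ‖z♮‖² = 0`, so `v = 0`.
  rw [hvz, inner_smul_right, inner_self_eq_norm_sq_to_K] at him
  have h5 : c * ‖stack xs (meas A xs)‖ ^ 2 = 0 := by
    rw [mul_assoc, mul_comm Complex.I, ← mul_assoc, RCLike.ofReal_eq_complex_ofReal,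
      ← Complex.ofReal_pow, ← Complex.ofReal_neg, ← Complex.ofReal_mul, Complex.im_ofReal_mul,
      Complex.I_im] at him
    linarith
  apply hv
  rcases mul_eq_zero.1 h5 with h | h
  · simp [hvz, h]
  · rw [hvz, norm_eq_zero.1 (sq_eq_zero_iff.1 h), smul_zero]

/-! ### Phase equivariance and local contraction. -/

theorem proxPhi_smul (α : Circle) (z : Stacked n m) :
    proxPhi b ((α : ℂ) • z) = (α : ℂ) • proxPhi b z := by
  apply WithLp.ofLp_injective
  refine Prod.ext rfl ?_
  change proxF b ((α : ℂ) • z.snd) = (α : ℂ) • proxF b z.snd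
  ext i
  simp only [proxF, PiLp.smul_apply, smul_eq_mul, phase_mul,
    phase_of_norm_eq_one (Circle.norm_coe α)]
  ring

theorem rgpsDRStep_smul (t : ℝ) (α : Circle) (z : Stacked n m) :
    rgpsDRStep A b t ((α : ℂ) • z) = (α : ℂ) • rgpsDRStep A b t z := by
  simp only [rgpsDRStep, robustProj, proxPhi_smul, map_sub, map_smul]
  module

theorem rgpsDRStep_self (hxs : ∀ i, ‖meas A xs i‖ = b i) (t : ℝ) :
    rgpsDRStep A b t (stack xs (meas A xs)) = stack xs (meas A xs) := by
  have hP : proxPhi b (stack xs (meas A xs)) = stack xs (meas A xs) := by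
    apply WithLp.ofLp_injective
    refine Prod.ext rfl ?_
    change proxF b (meas A xs) = meas A xs
    ext i
    change (b i : ℂ) * phase (meas A xs i) = meas A xs i
    rw [← hxs i, mul_comm, phase_mul_norm]
  have hG : graphProj A (stack xs (meas A xs)) = stack xs (meas A xs) :=
    (graphSet A).starProjection_eq_self_iff.2 rfl
  simp only [rgpsDRStep, robustProj, hP, map_sub, map_smul, hG]
  push_cast
  module

theorem exists_phaseDist_rgpsDRStep_le (hmag : MagnitudeRetrievalUnique A xs)
    (hxs : ∀ i, ‖meas A xs i‖ = b i) (hb : ∀ i, 0 < b i) {t : ℝ} (ht0 : 0 < t) (ht1 : t < 1) :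
    ∃ γ : ℝ, 0 < γ ∧ γ < 1 ∧ ∃ r : ℝ, 0 < r ∧ ∀ z : Stacked n m,
      phaseDist z (stack xs (meas A xs)) < r →
        phaseDist (rgpsDRStep A b t z) (stack xs (meas A xs))
          ≤ γ * phaseDist z (stack xs (meas A xs)) := by
  have h0 := meas_ne_zero_of_norm_eq hxs hb
  obtain ⟨g, hg0, hg1, hg⟩ := exists_norm_le_mul_of_norm_lt _ (stack xs (meas A xs))
    fun v hv him => norm_rgpsDRStep_deriv_lt hmag h0 ht0 ht1 hv him
  have hder := hasFDerivAt_rgpsDRStep (A := A) (z := stack xs (meas A xs)) h0 hxs t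
  set zs := stack xs (meas A xs)
  -- The remainder gets half of the gap `1 - g`, so the total rate is `g + (1 - g) / 2 = (1 + g) /
  -- 2`.
  obtain ⟨r, hr, hball⟩ := Metric.eventually_nhds_iff.1
    (hder.isLittleO.def (show 0 < (1 - g) / 2 by linarith))
  refine ⟨(1 + g) / 2, by linarith, by linarith, r, hr, fun z hz => ?_⟩
  obtain ⟨α, hα, him⟩ := exists_phaseDist_eq z zs
  -- By equivariance the best phase can be rotated away, so linearising at the single point `zs`
  -- serves the whole orbit.
  obtain ⟨v, hv⟩ : ∃ v, z = (α : ℂ) • (zs + v) :=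
    ⟨((α⁻¹ : Circle) : ℂ) • z - zs, by
      rw [add_sub_cancel, smul_smul, ← Circle.coe_mul, mul_inv_cancel, Circle.coe_one, one_smul]⟩
  have hsub : z - (α : ℂ) • zs = (α : ℂ) • v := by rw [hv]; module
  have hnorm : ∀ w : Stacked n m, ‖(α : ℂ) • w‖ = ‖w‖ := fun w => by
    rw [norm_smul, Circle.norm_coe, one_mul]
  rw [hsub, hnorm] at hα
  have himv : (inner ℂ zs v).im = 0 := by
    rw [hsub, inner_smul_left, inner_smul_right, ← mul_assoc, ← Circle.coe_inv_eq_conj,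
      ← Circle.coe_mul, inv_mul_cancel, Circle.coe_one, one_mul] at him
    exact him
  have hlin := hball (y := zs + v) (by simpa [dist_eq_norm, ← hα] using hz)
  rw [rgpsDRStep_self hxs, add_sub_cancel_left] at hlin
  have hstep : ‖rgpsDRStep A b t (zs + v) - zs‖ ≤ (1 + g) / 2 * ‖v‖ := by
    have := norm_add_le_of_le hlin (hg v himv)
    rw [show (fun i => phase (zs.snd i)) = fun i => phase (meas A xs i) from rfl,
      sub_add_cancel] at this
    linarith
  calc phaseDist (rgpsDRStep A b t z) zs
      ≤ ‖rgpsDRStep A b t z - (α : ℂ) • zs‖ := phaseDist_le _ _ α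
    _ = ‖rgpsDRStep A b t (zs + v) - zs‖ := by rw [hv, rgpsDRStep_smul, ← smul_sub, hnorm]
    _ ≤ (1 + g) / 2 * phaseDist z zs := by rw [hα]; exact hstep

/-! ### From the splitting iteration to the Douglas-Rachford map. -/

/-- The prox is the identity in `x`, so the dual update cancels. After one step the first
Douglas-Rachford component is `x` itself, and its error bounds that of `x`. -/
theorem rgpsStep_lam (t : ℝ) (s : State n m) : (rgpsStep A b t s).lam = 0 := by
  simp [rgpsStep, proxPhi]
  abel

/-- The new Douglas-Rachford variable is the argument of the prox. An arbitrary initial state need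
not satisfy this relation, which is why the recursion by `T` starts at index 1. -/
theorem rgpsStep_primal (t : ℝ) (s : State n m) :
    stack (rgpsStep A b t s).x (rgpsStep A b t s).y = proxPhi b (rgpsStep A b t s).dr := by
  apply WithLp.ofLp_injective
  refine Prod.ext ?_ ?_
  · simp [rgpsStep, proxPhi, State.dr]
    abel
  · simp [rgpsStep, proxPhi, State.dr]
    congr 1
    abel

theorem dr_rgpsStep (t : ℝ) {s : State n m} (hs : stack s.x s.y = proxPhi b s.dr) :
    (rgpsStep A b t s).dr = rgpsDRStep A b t s.dr := by
  have h : stack (s.x - s.lam) (s.y - s.nu) = (2 : ℂ) • proxPhi b s.dr - s.dr := by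
    rw [← hs]
    apply WithLp.ofLp_injective
    refine Prod.ext ?_ ?_
    · change s.x - s.lam = (2 : ℂ) • s.x - (s.lam + s.x)
      module
    · change s.y - s.nu = (2 : ℂ) • s.y - (s.nu + s.y)
      module
  have h2 : rgpsDRStep A b t s.dr
      = s.dr + robustProj A t (stack (s.x - s.lam) (s.y - s.nu)) - stack s.x s.y := by
    rw [rgpsDRStep, ← h, hs]
  rw [h2]
  apply WithLp.ofLp_injective
  refine Prod.ext ?_ ?_
  · simp [rgpsStep, State.dr]
    abel
  · simp [rgpsStep, State.dr]
    abel

theorem phaseDist_fst_le (x : EuclideanSpace ℂ (Fin n)) (y : EuclideanSpace ℂ (Fin m))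
    (z : Stacked n m) : phaseDist x z.fst ≤ phaseDist (stack x y) z := by
  obtain ⟨α, hα, -⟩ := exists_phaseDist_eq (stack x y) z
  rw [hα]
  refine (phaseDist_le _ _ α).trans ?_
  exact WithLp.norm_fst_le _ (stack x y - (α : ℂ) • z)

/-- Linear convergence of the iterates from linear contraction of the Douglas-Rachford step. -/
theorem phaseDist_iterate_le {t γ r : ℝ} {z : Stacked n m} (hγ0 : 0 < γ) (hγ1 : γ < 1)
    (hstep : ∀ w : Stacked n m, phaseDist w z < r →
      phaseDist (rgpsDRStep A b t w) z ≤ γ * phaseDist w z)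
    {s : ℕ → State n m} (hs : ∀ k, s (k + 1) = rgpsStep A b t (s k))
    (h1 : phaseDist (s 1).dr z < r) (k : ℕ) :
    phaseDist (s (k + 1)).dr z ≤ γ ^ k * phaseDist (s 1).dr z := by
  induction k with
  | zero => simp
  | succ k ih =>
    have hρ := phaseDist_nonneg (s 1).dr z
    -- The distance never exceeds its initial value, so the local contraction remains applicable.
    have hlt : phaseDist (s (k + 1)).dr z < r :=
      (ih.trans (mul_le_of_le_one_left hρ (pow_le_one₀ hγ0.le hγ1.le))).trans_lt h1
    have hP : stack (s (k + 1)).x (s (k + 1)).y = proxPhi b (s (k + 1)).dr := by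
      rw [hs k]; exact rgpsStep_primal t _
    rw [hs (k + 1), dr_rgpsStep t hP, pow_succ, mul_comm (γ ^ k), mul_assoc]
    exact (hstep _ hlt).trans (mul_le_mul_of_nonneg_left ih hγ0.le)

/-- At a fixed point the contraction reads `d ≤ γ d` with `γ < 1`, so `d = 0`; the minimum over
phases is attained, which puts the point on the orbit. -/
theorem rgpsDRStep_eq_self_iff {t γ r : ℝ} (hxs : ∀ i, ‖meas A xs i‖ = b i) (hγ1 : γ < 1)
    (hstep : ∀ w : Stacked n m, phaseDist w (stack xs (meas A xs)) < r →
      phaseDist (rgpsDRStep A b t w) (stack xs (meas A xs))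
        ≤ γ * phaseDist w (stack xs (meas A xs)))
    {z : Stacked n m} (hz : phaseDist z (stack xs (meas A xs)) < r) :
    rgpsDRStep A b t z = z ↔ z ∈ phaseOrbit (stack xs (meas A xs)) := by
  constructor
  · intro hfix
    have h := hstep z hz
    rw [hfix] at h
    have h0 : phaseDist z (stack xs (meas A xs)) = 0 :=
      le_antisymm (by nlinarith) (phaseDist_nonneg _ _)
    obtain ⟨α, hα, -⟩ := exists_phaseDist_eq z (stack xs (meas A xs))
    exact ⟨α, sub_eq_zero.1 (norm_eq_zero.1 (hα.symm.trans h0))⟩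
  · rintro ⟨α, rfl⟩
    rw [rgpsDRStep_smul, rgpsDRStep_self hxs]

end PhaseRetrieval

theorem theorem3p3 {n m : ℕ} (hn : 0 < n)
    (A : Matrix (Fin n) (Fin m) ℂ) (b : Fin m → ℝ) (xs : EuclideanSpace ℂ (Fin n))
    (hA : Function.Injective (PhaseRetrieval.meas A))
    (hxs : ∀ i, ‖PhaseRetrieval.meas A xs i‖ = b i)
    (hb : ∀ i, 0 < b i)
    (hmag : PhaseRetrieval.MagnitudeRetrievalUnique A xs)
    (L : Matrix (Fin n) (Fin n) ℂ) (hL : L * Lᴴ = 1 + A * Aᴴ)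
    (ωx : Fin n → ℂ) (hω : ∀ j, ‖ωx j‖ = 1 ∧ xs j = (‖xs j‖ : ℂ) * ωx j) :
    let zs := PhaseRetrieval.stack xs (PhaseRetrieval.meas A xs)
    let β := PhaseRetrieval.betaTilde A L xs ωx
    (0 < β ∧ β < 1) ∧ (0 < PhaseRetrieval.tMax β ∧ PhaseRetrieval.tMax β < 1) ∧
    ∀ t : ℝ, 0 < t → t < PhaseRetrieval.tMax β →
      ∃ γ : ℝ, 0 < γ ∧ γ < 1 ∧
        ∃ ε : ℝ → ℝ, Tendsto ε (𝓝[>] 0) (𝓝 0) ∧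
          ∃ r : ℝ, 0 < r ∧
            (∀ z : PhaseRetrieval.Stacked n m, PhaseRetrieval.phaseDist z zs < r →
              (PhaseRetrieval.rgpsDRStep A b t z = z ↔ z ∈ PhaseRetrieval.phaseOrbit zs)) ∧
            ∀ s : ℕ → PhaseRetrieval.State n m,
              (∀ k, s (k + 1) = PhaseRetrieval.rgpsStep A b t (s k)) →
              PhaseRetrieval.phaseDist (s 1).dr zs < r →
              ∀ k : ℕ, 1 ≤ k →
                PhaseRetrieval.phaseDist (s k).x xs ≤
                  (γ + ε (PhaseRetrieval.phaseDist (s 1).dr zs)) ^ (k - 1) *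
                    PhaseRetrieval.phaseDist (s 1).dr zs := by

  open PhaseRetrieval in
  have h0 := meas_ne_zero_of_norm_eq hxs hb
  have hβ := betaTilde_mem_Ioo (sigma2_lt_one hmag h0 hL hω) (delta1_mem_Ioo (sMin_pos hn hA))
  have hT := tMax_mem_Ioo hβ
  refine ⟨hβ, hT, fun t ht0 ht => ?_⟩
  obtain ⟨γ, hγ0, hγ1, r, hr, hstep⟩ :=
    exists_phaseDist_rgpsDRStep_le hmag hxs hb ht0 (ht.trans hT.2)
  -- Any rate strictly above the norm of the derivative absorbs the remainder on a small ball, so the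
  -- correction to the rate can be taken to vanish.
  refine ⟨γ, hγ0, hγ1, fun _ => 0, tendsto_const_nhds, r, hr,
    fun z hz => rgpsDRStep_eq_self_iff hxs hγ1 hstep hz, fun s hs hρ k hk => ?_⟩
  obtain ⟨k, rfl⟩ := Nat.exists_eq_add_of_le' hk
  rw [add_zero, Nat.add_sub_cancel]
  refine le_trans ?_ (phaseDist_iterate_le hγ0 hγ1 hstep hs hρ k)
  have hx : (s (k + 1)).dr = stack (s (k + 1)).x ((s (k + 1)).nu + (s (k + 1)).y) := by
    rw [State.dr, show (s (k + 1)).lam = 0 by rw [hs k]; exact rgpsStep_lam t _, zero_add]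
  rw [hx]
  exact phaseDist_fst_le _ _ (stack xs (meas A xs))
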